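/- **Setting.** Let $T$ be a punctured tiling of $\mathbb R^d$ (possibly with decorated tiles): a countable covering of $\mathbb R^d$ by tiles homeomorphic to a closed ball with pairwise disjoint interiors, each with a marked interior point (puncture), translates of the same decorated tile being punctured in the same way. Write $T^{punc}$ for the set of punctures, and for $r>0$ let $B_{0,r}[T]$ be the set of tiles of $T$ with puncture in the closed $r$-ball about $0$. An *$r$-patch* of $T$ is a set $B_{0,r}[T-x]$ with $x\in T^{punc}$; $P(r)$ is the number of $r$-patches, and $T$ has *finite local complexity* if $P(r)<\infty$ for all $r>0$. The frequency of an $r$-patch $p$ is $\mathrm{freq}(p)=\lim_{n\to\infty} n^{-d}\,\#\{x\in T^{punc}\cap C_n : B_{0,r}[T-x]=p\}$, where $C_n$ is the cube of side $n$ centred at $0$. $T$ has *equidistributed frequencies* if all these limits exist and there are $c,C>0$ with $cP(r)^{-1}\le \mathrm{freq}(p)\le CP(r)^{-1}$ for all $r>0$ and all $r$-patches $p$. The *discrete tiling space* $\Xi$ of $T$ is the set of punctured tilings $T'$ of $\mathbb R^d$ with $0\in T'^{punc}$ that have, for each $r>0$, the same $r$-patches as $T$. For a strictly decreasing function $\delta:[0,\infty)\to\mathbb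 R$ tending to $0$ at infinity, $\Xi$ carries the ultrametric $d(\xi,\eta)=\inf\{\delta(r): r=0 \text{ or } B_{0,r}[\xi]=B_{0,r}[\eta]\}$. **Spectral distances.** Let $\mathcal T$ be the Michon tree of $(\Xi,d)$: its vertices are the closed balls of positive radius, and the children of a vertex $v$ are the maximal closed balls of positive radius properly contained in $v$. A *choice function* $\tau$ assigns to each vertex $v$ a point $\tau(v)\in v$ such that $\tau(w)=\tau(v)$ whenever $w\subseteq v$ and $\tau(v)\in w$. Let $E=E(\tau)$ be the set of pairs $e=(\tau(v),\tau(w))$ with $v\ne w$ children of the same vertex; put $l(x,y)=d(x,y)$, $s(x,y)=x$ and $\widetilde{(x,y)}=(y,x)$. On $\ell^2(E)$ let $\pi_\tau(f)\psi(e)=f(s(e))\psi(e)$ for (bounded) continuous $f:\Xi\to\mathbb C$, and $D\psi(e)=l(e)^{-1}\psi(\tilde e)$ on the maximal domain. Let $$d_s^\tau(\xi,\eta)=\sup\{|f(\xi)-f(\eta)| : \|[D,\pi_\tau(f)]\|\le 1\},\qquad \overline d_s=\sup_\tau d_s^\tau,\qquad \underline d_s=\inf_\tau d_s^\tau .$$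 **Theorem.** Let $T$ have finite local complexity and equidistributed frequencies, and suppose that there is a constant $\tilde c$ with $P(4r)\le\tilde c\,P(r)$ for all sufficiently large $r$. Let $\delta$ be as above and suppose that $\delta(ar)\le\delta(a)\delta(r)$ for all sufficiently large $a$ and $r$, and that $\delta\in L^1([1,\infty),\frac{dx}{x})$. Then $\overline d_s$ is Lipschitz equivalent to $d$ and to $\underline d_s$: there is a constant $C>0$ such that for all $\xi,\eta\in\Xi$ $$d(\xi,\eta)\le\overline d_s(\xi,\eta)\le C\,d(\xi,\eta)\qquad\text{and}\qquad \underline d_s(\xi,\eta)\le\overline d_s(\xi,\eta)\le C\,\underline d_s(\xi,\eta).$$ -/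

import Mathlib

open Set Filter Topology MeasureTheory
open scoped ENNReal NNReal BoundedContinuousFunction

noncomputable section

namespace TilingSpectral

/-! ## Punctured tilings of `ℝ^d` -/

/-- A subset of `ℝ^d` carrying a puncture (a marked point) and a decoration (label).
Undecorated tilings are the case `L = Unit`. -/
@[ext]
structure MarkedSet (d : ℕ) (L : Type*) where
  carrier : Set (EuclideanSpace ℝ (Fin d))
  puncture : EuclideanSpace ℝ (Fin d)
  label : L

section Tilings

variable {d : ℕ} {L : Type*}

/-- A punctured tile: a set homeomorphic to a closed ball, with its puncture in its interior. -/
structure IsTile (t : MarkedSet d L) : Prop where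
  homeo_ball : Nonempty (t.carrier ≃ₜ Metric.closedBall (0 : EuclideanSpace ℝ (Fin d)) 1)
  puncture_mem : t.puncture ∈ interior t.carrier

/-- The translate `t - x`. -/
def MarkedSet.sub (t : MarkedSet d L) (x : EuclideanSpace ℝ (Fin d)) : MarkedSet d L where
  carrier := (fun y => y - x) '' t.carrier
  puncture := t.puncture - x
  label := t.label

/-- A punctured tiling of `ℝ^d`: a countable collection of punctured tiles which covers `ℝ^d`,
whose tiles have pairwise disjoint interiors, and whose punctures are chosen in a
translationally coherent way. -/
structure IsPuncturedTiling (T : Set (MarkedSet d L)) : Prop where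
  countable : T.Countable
  isTile : ∀ t ∈ T, IsTile t
  cover : ⋃ t ∈ T, t.carrier = univ
  nonoverlapping : ∀ t ∈ T, ∀ t' ∈ T, t ≠ t' → Disjoint (interior t.carrier) (interior t'.carrier)
  coherent : ∀ t ∈ T, ∀ t' ∈ T, ∀ x : EuclideanSpace ℝ (Fin d),
    t'.carrier = (t.sub x).carrier → t'.label = t.label → t'.puncture = t.puncture - x

/-- The set `T^punc` of punctures of the tiles of `T`. -/
def punctures (T : Set (MarkedSet d L)) : Set (EuclideanSpace ℝ (Fin d)) :=
  MarkedSet.puncture '' T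

/-- The translate `T - x` of a collection of tiles. -/
def translate (T : Set (MarkedSet d L)) (x : EuclideanSpace ℝ (Fin d)) : Set (MarkedSet d L) :=
  (fun t => t.sub x) '' T

/-- `B_{0,r}[T]`: the tiles of `T` whose punctures lie in the closed `r`-ball about the origin. -/
def centralPatch (r : ℝ) (T : Set (MarkedSet d L)) : Set (MarkedSet d L) :=
  {t ∈ T | ‖t.puncture‖ ≤ r}

/-- The `r`-patches of `T`: the sets `B_{0,r}[T - x]` for `x ∈ T^punc`. They are already
translated so that their central puncture is the origin. -/
def patches (T : Set (MarkedSet d L)) (r : ℝ) : Set (Set (MarkedSet d L)) :=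
  {p | ∃ x ∈ punctures T, p = centralPatch r (translate T x)}

/-- Finite local complexity: for every `r > 0` there are finitely many `r`-patches. -/
def FiniteLocalComplexity (T : Set (MarkedSet d L)) : Prop :=
  ∀ r : ℝ, 0 < r → (patches T r).Finite

/-- The patch counting function. -/
def patchCount (T : Set (MarkedSet d L)) (r : ℝ) : ℕ := (patches T r).ncard

/-- The set of occurrences in `T` of the `r`-patch `p`. -/
def occurrences (T : Set (MarkedSet d L)) (r : ℝ) (p : Set (MarkedSet d L)) :
    Set (EuclideanSpace ℝ (Fin d)) :=
  {x ∈ punctures T | centralPatch r (translate T x) = p}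

/-- The cube of side length `n` centred at the origin; its volume is `n ^ d`. -/
def cube (d n : ℕ) : Set (EuclideanSpace ℝ (Fin d)) := {y | ∀ i, |y i| ≤ (n : ℝ) / 2}

/-- The frequency of the `r`-patch `p` in `T` exists and equals `φ`. -/
def HasFrequency (T : Set (MarkedSet d L)) (r : ℝ) (p : Set (MarkedSet d L)) (φ : ℝ) : Prop :=
  Tendsto (fun n : ℕ => ((occurrences T r p ∩ cube d n).ncard : ℝ) / (n : ℝ) ^ d) atTop (𝓝 φ)

/-- Equidistributed frequencies: all patch frequencies exist, and those of `r`-patches are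
comparable to the inverse of the patch counting function, uniformly in `r`. -/
def EquidistributedFrequencies (T : Set (MarkedSet d L)) : Prop :=
  ∃ c C : ℝ, 0 < c ∧ 0 < C ∧ ∀ r : ℝ, 0 < r → ∀ p ∈ patches T r,
    ∃ φ : ℝ, HasFrequency T r p φ ∧
      c * (patchCount T r : ℝ)⁻¹ ≤ φ ∧ φ ≤ C * (patchCount T r : ℝ)⁻¹

end Tilings

/-! ## The discrete tiling space and its metric -/

/-- A strictly decreasing real function on `[0, ∞)` tending to `0` at infinity
(its values at negative arguments are irrelevant). -/
structure DecayFunction where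
  toFun : ℝ → ℝ
  strictAntiOn : StrictAntiOn toFun (Ici 0)
  tendsto_zero : Tendsto toFun atTop (𝓝 0)

instance : CoeFun DecayFunction (fun _ => ℝ → ℝ) := ⟨DecayFunction.toFun⟩

/-- The discrete tiling space `Ξ` of `T`: the punctured tilings of `ℝ^d` which have a puncture at
the origin and, for each `r > 0`, the same `r`-patches as `T`. The parameter `δ` only records
which metric is put on the space. -/
def DiscreteTilingSpace {d : ℕ} {L : Type*} (T : Set (MarkedSet d L)) (_δ : DecayFunction) :=
  {T' : Set (MarkedSet d L) // IsPuncturedTiling T' ∧ (∀ r : ℝ, 0 < r → patches T' r = patches T r) ∧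
    (0 : EuclideanSpace ℝ (Fin d)) ∈ punctures T'}

section TilingMetric

variable {d : ℕ} {L : Type*}

/-- The radii of coincidence of two collections of tiles. The patch of radius `0` is the empty
patch, so `0` always belongs to this set. -/
def coincidenceRadii (ξ η : Set (MarkedSet d L)) : Set ℝ :=
  {r | r = 0 ∨ (0 < r ∧ centralPatch r ξ = centralPatch r η)}

/-- `d(ξ, η) = inf {δ(r) : B_{0,r}[ξ] = B_{0,r}[η]}`; the value is `δ(0)` if `ξ` and `η` already
differ in the tile at the origin. -/
def tilingDist (δ : DecayFunction) (ξ η : Set (MarkedSet d L)) : ℝ :=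
  sInf (δ '' coincidenceRadii ξ η)

theorem coincidenceRadii_nonneg {ξ η : Set (MarkedSet d L)} {r : ℝ}
    (hr : r ∈ coincidenceRadii ξ η) : 0 ≤ r := by
  rcases hr with h | h
  · exact h.ge
  · exact h.1.le

theorem DecayFunction.pos (δ : DecayFunction) {r : ℝ} (hr : 0 ≤ r) : 0 < δ r := by
  have h1 : δ (r + 1) < δ r :=
    δ.strictAntiOn hr (by simp only [mem_Ici]; linarith) (by linarith)
  have h2 : 0 ≤ δ (r + 1) := by
    refine le_of_tendsto δ.tendsto_zero ?_
    filter_upwards [eventually_ge_atTop (r + 1)] with s hs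
    exact δ.strictAntiOn.antitoneOn (by simp only [mem_Ici]; linarith)
      (by simp only [mem_Ici]; linarith) hs
  linarith

theorem bddBelow_coincidence (δ : DecayFunction) (ξ η : Set (MarkedSet d L)) :
    BddBelow (δ '' coincidenceRadii ξ η) := by
  refine ⟨0, ?_⟩
  rintro _ ⟨r, hr, rfl⟩
  exact (δ.pos (coincidenceRadii_nonneg hr)).le

theorem nonempty_coincidence (δ : DecayFunction) (ξ η : Set (MarkedSet d L)) :
    (δ '' coincidenceRadii ξ η).Nonempty := ⟨δ 0, 0, Or.inl rfl, rfl⟩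

theorem tilingDist_comm (δ : DecayFunction) (ξ η : Set (MarkedSet d L)) :
    tilingDist δ ξ η = tilingDist δ η ξ := by
  have : coincidenceRadii ξ η = coincidenceRadii η ξ := by
    ext r
    simp only [coincidenceRadii, mem_ofPred_eq, eq_comm (a := centralPatch r ξ)]
  rw [tilingDist, tilingDist, this]

theorem tilingDist_nonneg (δ : DecayFunction) (ξ η : Set (MarkedSet d L)) :
    0 ≤ tilingDist δ ξ η := by
  refine le_csInf (nonempty_coincidence δ ξ η) ?_
  rintro _ ⟨r, hr, rfl⟩
  exact (δ.pos (coincidenceRadii_nonneg hr)).le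

theorem tilingDist_self (δ : DecayFunction) (ξ : Set (MarkedSet d L)) :
    tilingDist δ ξ ξ = 0 := by
  refine le_antisymm ?_ (tilingDist_nonneg δ ξ ξ)
  refine ge_of_tendsto δ.tendsto_zero ?_
  filter_upwards [eventually_gt_atTop (0 : ℝ)] with r hr
  exact csInf_le (bddBelow_coincidence δ ξ ξ) ⟨r, Or.inr ⟨hr, rfl⟩, rfl⟩

theorem centralPatch_eq_of_le {ξ η : Set (MarkedSet d L)} {r s : ℝ} (hrs : r ≤ s)
    (h : centralPatch s ξ = centralPatch s η) : centralPatch r ξ = centralPatch r η := by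
  ext t
  have h1 : t ∈ centralPatch s ξ ↔ t ∈ centralPatch s η := by rw [h]
  simp only [centralPatch, mem_ofPred_eq] at h1 ⊢
  constructor
  · rintro ⟨ht, htr⟩
    exact ⟨(h1.1 ⟨ht, htr.trans hrs⟩).1, htr⟩
  · rintro ⟨ht, htr⟩
    exact ⟨(h1.2 ⟨ht, htr.trans hrs⟩).1, htr⟩

theorem min_mem_coincidence {ξ η ζ : Set (MarkedSet d L)} {r s : ℝ}
    (hr : r ∈ coincidenceRadii ξ η) (hs : s ∈ coincidenceRadii η ζ) :
    min r s ∈ coincidenceRadii ξ ζ := by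
  rcases hr with rfl | ⟨hr, hr'⟩
  · exact Or.inl (min_eq_left (coincidenceRadii_nonneg hs))
  rcases hs with rfl | ⟨hs, hs'⟩
  · exact Or.inl (min_eq_right hr.le)
  exact Or.inr ⟨lt_min hr hs, (centralPatch_eq_of_le (min_le_left _ _) hr').trans
    (centralPatch_eq_of_le (min_le_right _ _) hs')⟩

theorem tilingDist_le_max (δ : DecayFunction) (ξ η ζ : Set (MarkedSet d L)) :
    tilingDist δ ξ ζ ≤ max (tilingDist δ ξ η) (tilingDist δ η ζ) := by
  by_contra! hlt
  obtain ⟨h1, h2⟩ := max_lt_iff.1 hlt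
  obtain ⟨_, ⟨r, hr, rfl⟩, hr'⟩ := exists_lt_of_csInf_lt (nonempty_coincidence δ ξ η) h1
  obtain ⟨_, ⟨s, hs, rfl⟩, hs'⟩ := exists_lt_of_csInf_lt (nonempty_coincidence δ η ζ) h2
  have h3 : tilingDist δ ξ ζ ≤ δ (min r s) :=
    csInf_le (bddBelow_coincidence δ ξ ζ) ⟨_, min_mem_coincidence hr hs, rfl⟩
  rcases min_choice r s with h | h <;> rw [h] at h3 <;> linarith

theorem eq_of_tilingDist_eq_zero (δ : DecayFunction) {ξ η : Set (MarkedSet d L)}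
    (h : tilingDist δ ξ η = 0) : ξ = η := by
  have key : ∀ R : ℝ, 0 < R → centralPatch R ξ = centralPatch R η := by
    intro R hR
    have h1 : sInf (δ '' coincidenceRadii ξ η) < δ R := by
      change tilingDist δ ξ η < δ R
      rw [h]
      exact δ.pos hR.le
    obtain ⟨_, ⟨r, hr, rfl⟩, hr'⟩ := exists_lt_of_csInf_lt (nonempty_coincidence δ ξ η) h1
    have hRr : R < r := (δ.strictAntiOn.lt_iff_gt (coincidenceRadii_nonneg hr) hR.le).1 hr'
    rcases hr with rfl | ⟨_, hr⟩
    · exact absurd hRr (not_lt.2 hR.le)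
    · exact centralPatch_eq_of_le hRr.le hr
  ext t
  have hpos : (0 : ℝ) < ‖t.puncture‖ + 1 := by positivity
  have h1 : t ∈ centralPatch (‖t.puncture‖ + 1) ξ ↔ t ∈ centralPatch (‖t.puncture‖ + 1) η := by
    rw [key _ hpos]
  have h2 : ‖t.puncture‖ ≤ ‖t.puncture‖ + 1 := by linarith
  simpa only [centralPatch, mem_ofPred_eq, h2, and_true] using h1

/-- The metric on the discrete tiling space defined by `δ`. -/
instance (T : Set (MarkedSet d L)) (δ : DecayFunction) : MetricSpace (DiscreteTilingSpace T δ) where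
  dist ξ η := tilingDist δ ξ.1 η.1
  dist_self ξ := tilingDist_self δ ξ.1
  dist_comm ξ η := tilingDist_comm δ ξ.1 η.1
  dist_triangle ξ η ζ := by
    refine (tilingDist_le_max δ ξ.1 η.1 ζ.1).trans (max_le ?_ ?_)
    · exact le_add_of_nonneg_right (tilingDist_nonneg δ _ _)
    · exact le_add_of_nonneg_left (tilingDist_nonneg δ _ _)
  eq_of_dist_eq_zero h := Subtype.ext (eq_of_tilingDist_eq_zero δ h)

instance (T : Set (MarkedSet d L)) (δ : DecayFunction) :
    IsUltrametricDist (DiscreteTilingSpace T δ) where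
  dist_triangle_max ξ η ζ := tilingDist_le_max δ ξ.1 η.1 ζ.1

end TilingMetric

/-! ## Spectral triples of an ultrametric space -/

/-- The vertices of the Michon tree of an ultrametric space `X`: the closed balls of positive
radius, ordered by inclusion. The tree is the Hasse diagram of this order: `w ⋖ v` says that `w` is
a child of `v`. Levels at which a ball does not split are contracted; they carry no horizontal
edges and no freedom of choice. -/
def MichonVertex (X : Type*) [MetricSpace X] :=
  {v : Set X // ∃ x : X, ∃ ρ : ℝ, 0 < ρ ∧ v = Metric.closedBall x ρ}

instance (X : Type*) [MetricSpace X] : PartialOrder (MichonVertex X) :=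
  inferInstanceAs (PartialOrder
    {v : Set X // ∃ x : X, ∃ ρ : ℝ, 0 < ρ ∧ v = Metric.closedBall x ρ})

/-- A choice function: it sends each vertex `v` to an infinite path through `v` (that is, a point
of the ball `v`), and if the path chosen at `v` goes through a vertex `w` below `v`, then the same
path is chosen at `w`. -/
structure ChoiceFunction (X : Type*) [MetricSpace X] where
  toFun : MichonVertex X → X
  mem : ∀ v, toFun v ∈ v.1
  coherent : ∀ v w : MichonVertex X, w ≤ v → toFun v ∈ w.1 → toFun w = toFun v

section Spectral

variable {X : Type*} [MetricSpace X]

/-- The (oriented) edges of the approximation graph `Γ(τ)`, its vertices being identified with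
points of `X` through `τ`: there is an edge from `τ v` to `τ w` if `v` and `w` are two distinct
children of the same vertex. -/
def edges (τ : ChoiceFunction X) : Set (X × X) :=
  {e | ∃ u v w : MichonVertex X, v ⋖ u ∧ w ⋖ u ∧ v ≠ w ∧ e = (τ.toFun v, τ.toFun w)}

/-- The edge with the opposite orientation. -/
def edgeFlip (τ : ChoiceFunction X) (e : edges τ) : edges τ :=
  ⟨(e.1.2, e.1.1), by
    obtain ⟨u, v, w, hv, hw, hvw, h⟩ := e.2
    exact ⟨u, w, v, hw, hv, hvw.symm, by rw [h]⟩⟩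

/-- The length of an edge is the distance of its endpoints. -/
def edgeLength (τ : ChoiceFunction X) (e : edges τ) : ℝ := dist e.1.1 e.1.2

/-- The Hilbert space `ℓ²(E)` of the spectral triple. -/
abbrev edgeSpace (τ : ChoiceFunction X) : Type _ := lp (fun _ : edges τ => ℂ) 2

theorem memℓp_rep (τ : ChoiceFunction X) (f : X →ᵇ ℂ) (ψ : edgeSpace τ) :
    Memℓp (fun e : edges τ => f e.1.1 * ψ e) 2 := by
  have h2 : (0 : ℝ) < (2 : ℝ≥0∞).toReal := by norm_num
  have hs := (lp.memℓp ψ).summable h2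
  refine memℓp_gen ?_
  refine Summable.of_nonneg_of_le (fun e => by positivity) (fun e => ?_)
    (hs.mul_left (‖f‖ ^ (2 : ℝ≥0∞).toReal))
  rw [norm_mul, Real.mul_rpow (norm_nonneg _) (norm_nonneg _)]
  gcongr
  exact f.norm_coe_le_norm _

/-- The representation: `π_τ(f) ψ(e) = f(s(e)) ψ(e)`, where `s(e)` is the source of `e`. -/
def rep (τ : ChoiceFunction X) (f : X →ᵇ ℂ) : edgeSpace τ →ₗ[ℂ] edgeSpace τ where
  toFun ψ := ⟨fun e => f e.1.1 * ψ e, memℓp_rep τ f ψ⟩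
  map_add' ψ φ := by
    ext e
    exact mul_add _ _ _
  map_smul' a ψ := by
    ext e
    exact mul_left_comm _ _ _

/-- The domain of the Dirac operator: all `ψ ∈ ℓ²(E)` for which `e ↦ l(e)⁻¹ ψ(ẽ)` is in `ℓ²(E)`. -/
def diracDomain (τ : ChoiceFunction X) : Submodule ℂ (edgeSpace τ) where
  carrier := {ψ | Memℓp (fun e : edges τ => ((edgeLength τ e)⁻¹ : ℂ) * ψ (edgeFlip τ e)) 2}
  add_mem' := by
    intro ψ φ hψ hφ
    have h := Memℓp.add hψ hφ
    refine (congrArg (fun g : edges τ → ℂ => Memℓp g 2) (funext fun e => ?_)).mp h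
    exact (mul_add _ _ _).symm
  zero_mem' := by
    have h : Memℓp (0 : edges τ → ℂ) 2 := zero_memℓp
    refine (congrArg (fun g : edges τ → ℂ => Memℓp g 2) (funext fun e => ?_)).mp h
    exact (mul_zero _).symm
  smul_mem' := by
    intro a ψ hψ
    have h := Memℓp.const_smul hψ a
    refine (congrArg (fun g : edges τ → ℂ => Memℓp g 2) (funext fun e => ?_)).mp h
    exact mul_left_comm _ _ _

/-- The Dirac operator `D ψ(e) = l(e)⁻¹ ψ(ẽ)` on its maximal domain in `ℓ²(E)`. -/
def dirac (τ : ChoiceFunction X) : edgeSpace τ →ₗ.[ℂ] edgeSpace τ where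
  domain := diracDomain τ
  toFun :=
    { toFun := fun ψ =>
        ⟨fun e => ((edgeLength τ e)⁻¹ : ℂ) * (ψ : edgeSpace τ) (edgeFlip τ e), ψ.2⟩
      map_add' := by
        intro ψ φ
        ext e
        exact mul_add _ _ _
      map_smul' := by
        intro a ψ
        ext e
        exact mul_left_comm _ _ _ }

/-- `‖[D, π_τ(f)]‖ ≤ 1`: the operator `π_τ(f)` preserves the domain of `D`, and the commutator,
defined on that domain, is bounded by `1`. -/
def CommutatorNormLeOne (τ : ChoiceFunction X) (f : X →ᵇ ℂ) : Prop :=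
  ∀ ψ : (dirac τ).domain, ∃ h : rep τ f ψ ∈ (dirac τ).domain,
    ‖dirac τ ⟨rep τ f ψ, h⟩ - rep τ f (dirac τ ψ)‖ ≤ ‖(ψ : edgeSpace τ)‖

/-- The spectral (Connes) distance `d_s^τ`. On a compact space the bounded continuous functions are
all the continuous functions. -/
def spectralDist (τ : ChoiceFunction X) (x y : X) : ℝ≥0∞ :=
  ⨆ (f : X →ᵇ ℂ) (_ : CommutatorNormLeOne τ f), ‖f x - f y‖ₑ

/-- The supremum of the spectral distances over all choice functions. -/
def upperSpectralDist (x y : X) : ℝ≥0∞ := ⨆ τ : ChoiceFunction X, spectralDist τ x y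

/-- The infimum of the spectral distances over all choice functions. -/
def lowerSpectralDist (x y : X) : ℝ≥0∞ := ⨅ τ : ChoiceFunction X, spectralDist τ x y

end Spectral

end TilingSpectral

end

/-! The commutator acts by `ψ ↦ l(e)⁻¹ (f(t(e)) - f(s(e))) ψ(ẽ)`, where `t(e)` is the target of `e`.
If its norm is at most 1, then `f` varies by at most `l(e)` along each edge; conversely, every
bounded 1-Lipschitz `f` is admissible. A truncated distance function therefore gives `d ≤ d_s^τ` for
every `τ` (`edist_le_spectralDist`), and everything reduces to `d_s^τ ≤ C d` with `C` independent of
`τ`.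

Let `d(ξ, η) = s`. The open `s`-balls about `ξ` and `η` are siblings in the Michon tree, so the edge
between their chosen points costs at most `s`. Descending from either chosen point to the centre of
its ball costs at most `t` at each distance `t < s` occurring from that centre. Hence `|f(ξ) -
f(η)|` is at most `s` plus two sums of such distances (`spectralDist_le`), and it suffices that the
distances below `s` from any point add up to `O(s)`.

This is a counting statement. Distances from `ξ` in `(δ b, δ a)` are realised by points whose
`b`-patches are distinct and all extend the `a`-patch of `ξ`. Their frequencies add up to at most
that of the `a`-patch, so equidistribution bounds their number by a multiple of `P(b)/P(a)`
(`exists_card_distances_le`). By the growth bound on `P`, boundedly many distances lie between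
consecutive levels `δ(4ⁿ R)`. Integrability and submultiplicativity of `δ` make the sum of the
levels from any one onwards comparable to that level (`DecayFunction.exists_summable_bound`). -/

namespace TilingSpectral

section Spectral

variable {X : Type*} [MetricSpace X]

/-! ## The commutator condition -/

/-- Test the commutator on the unit vector at the flipped edge. -/
theorem norm_sub_le_of_commutatorNormLeOne {τ : ChoiceFunction X} {f : X →ᵇ ℂ}
    (hf : CommutatorNormLeOne τ f) (e : edges τ) : ‖f e.1.1 - f e.1.2‖ ≤ dist e.1.1 e.1.2 := by
  classical
  -- Without an ultrametric hypothesis an edge may have length 0, and then `0⁻¹ = 0` gives no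
  -- information; but its endpoints coincide.
  rcases eq_or_ne (dist e.1.1 e.1.2) 0 with h0 | h0
  · rw [h0, eq_of_dist_eq_zero h0, sub_self, norm_zero]
  have hpos : 0 < dist e.1.1 e.1.2 := lt_of_le_of_ne dist_nonneg h0.symm
  let ψ : edgeSpace τ := lp.single 2 (edgeFlip τ e) (1 : ℂ)
  have hψe : ψ (edgeFlip τ e) = 1 := lp.single_apply_self 2 (edgeFlip τ e) 1
  have hψ : ψ ∈ diracDomain τ := by
    have h := lp.memℓp (lp.single (E := fun _ : edges τ => ℂ) 2 e ((edgeLength τ e)⁻¹ : ℂ))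
    refine (congrArg (fun g : edges τ → ℂ => Memℓp g 2) (funext fun e' => ?_)).mp h
    rcases eq_or_ne e' e with rfl | hne
    · rw [hψe, lp.single_apply_self, mul_one]
    · have hne' : edgeFlip τ e' ≠ edgeFlip τ e := fun h => hne (congrArg (edgeFlip τ) h)
      have h1 : ψ (edgeFlip τ e') = 0 := lp.single_apply_ne 2 (edgeFlip τ e) 1 hne'
      rw [h1, lp.single_apply_ne 2 e _ hne, mul_zero]
  obtain ⟨h, hle⟩ := hf ⟨ψ, hψ⟩
  have h1 : ‖(ψ : edgeSpace τ)‖ = 1 := by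
    have := lp.norm_single (E := fun _ : edges τ => ℂ) (p := 2) (by norm_num)
      (edgeFlip τ e) (1 : ℂ)
    rw [norm_one] at this
    exact this
  have h2 := (lp.norm_apply_le_norm (by norm_num)
    (dirac τ ⟨rep τ f ψ, h⟩ - rep τ f (dirac τ ⟨ψ, hψ⟩)) e).trans hle
  have h3 : (dirac τ ⟨rep τ f ψ, h⟩ - rep τ f (dirac τ ⟨ψ, hψ⟩) : edgeSpace τ) e =
      ((edgeLength τ e)⁻¹ : ℂ) * (f e.1.2 * ψ (edgeFlip τ e)) -
        f e.1.1 * (((edgeLength τ e)⁻¹ : ℂ) * ψ (edgeFlip τ e)) := rfl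
  change _ ≤ ‖(ψ : edgeSpace τ)‖ at h2
  rw [h3, h1, hψe, mul_one, mul_one, mul_comm (f e.1.1), ← mul_sub, norm_mul, norm_inv,
    Complex.norm_real, edgeLength, Real.norm_of_nonneg dist_nonneg, norm_sub_rev] at h2
  rwa [inv_mul_le_iff₀ hpos, mul_one] at h2

theorem commutatorNormLeOne_of_lipschitz (τ : ChoiceFunction X) {f : X →ᵇ ℂ}
    (hf : ∀ x y, ‖f x - f y‖ ≤ dist x y) : CommutatorNormLeOne τ f := by
  have h2 : (0 : ℝ) < (2 : ℝ≥0∞).toReal := by norm_num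
  intro ψ
  -- `D π(f) ψ (e)` is `f(t(e))` times `D ψ (e)`, so boundedness of `f` preserves the domain.
  have hdom : rep τ f ψ ∈ (dirac τ).domain := by
    have hs := (show Memℓp (fun e : edges τ =>
      ((edgeLength τ e)⁻¹ : ℂ) * (ψ : edgeSpace τ) (edgeFlip τ e)) 2 from ψ.2).summable h2
    refine memℓp_gen (Summable.of_nonneg_of_le (fun e => by positivity) (fun e => ?_)
      (hs.mul_left (‖f‖ ^ (2 : ℝ≥0∞).toReal)))
    rw [← Real.mul_rpow (norm_nonneg _) (norm_nonneg _)]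
    gcongr
    change ‖((edgeLength τ e)⁻¹ : ℂ) * (f e.1.2 * (ψ : edgeSpace τ) (edgeFlip τ e))‖ ≤ _
    rw [mul_left_comm, norm_mul]
    gcongr
    exact f.norm_coe_le_norm _
  refine ⟨hdom, ?_⟩
  set Φ : edgeSpace τ := dirac τ ⟨rep τ f ψ, hdom⟩ - rep τ f (dirac τ ψ) with hΦ
  have hΦe : ∀ e : edges τ, ‖Φ e‖ ≤ ‖(ψ : edgeSpace τ) (edgeFlip τ e)‖ := by
    intro e
    have h3 : Φ e =
      ((edgeLength τ e)⁻¹ : ℂ) * (f e.1.2 * (ψ : edgeSpace τ) (edgeFlip τ e)) -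
        f e.1.1 * (((edgeLength τ e)⁻¹ : ℂ) * (ψ : edgeSpace τ) (edgeFlip τ e)) := rfl
    have h4 : Φ e = (((edgeLength τ e)⁻¹ : ℂ) * (f e.1.2 - f e.1.1)) *
        (ψ : edgeSpace τ) (edgeFlip τ e) := by rw [h3]; ring
    rw [h4, norm_mul]
    refine mul_le_of_le_one_left (norm_nonneg _) ?_
    rw [norm_mul, norm_inv, Complex.norm_real, edgeLength, Real.norm_of_nonneg dist_nonneg,
      norm_sub_rev]
    exact inv_mul_le_one_of_le₀ (hf _ _) dist_nonneg
  -- Edge reversal is an involution, so `e ↦ ψ(ẽ)` has the same `ℓ²` norm as `ψ`.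
  let σ : edges τ ≃ edges τ := ⟨edgeFlip τ, edgeFlip τ, fun _ => rfl, fun _ => rfl⟩
  have hs := (lp.memℓp (ψ : edgeSpace τ)).summable h2
  have hs' := (σ.summable_iff (f := fun e => ‖(ψ : edgeSpace τ) e‖ ^ (2 : ℝ≥0∞).toReal)).2 hs
  refine lp.norm_le_of_tsum_le h2 (norm_nonneg _) ?_
  rw [lp.norm_rpow_eq_tsum h2, ← σ.tsum_eq fun e => ‖(ψ : edgeSpace τ) e‖ ^ (2 : ℝ≥0∞).toReal]
  refine Summable.tsum_le_tsum (fun e => ?_) ((lp.memℓp Φ).summable h2) hs'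
  exact Real.rpow_le_rpow (norm_nonneg _) (hΦe e) h2.le

/-! ## Choice functions and the lower bound -/

/-- Choose the least point of each ball for a well-order of `X`: if it lies in a smaller ball, it is
least there too. Existence matters for comparing the infimum over `τ` with the supremum. -/
instance : Nonempty (ChoiceFunction X) := by
  classical
  have wf : WellFounded (WellOrderingRel : X → X → Prop) := WellOrderingRel.isWellOrder.wf
  have hne : ∀ v : MichonVertex X, v.1.Nonempty := by
    rintro ⟨v, x, ρ, hρ, rfl⟩
    exact ⟨x, Metric.mem_closedBall_self hρ.le⟩
  refine ⟨⟨fun v => wf.min v.1 (hne v), fun v => wf.min_mem _ _, fun v w hwv h => ?_⟩⟩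
  rcases trichotomous_of (WellOrderingRel : X → X → Prop) (wf.min w.1 (hne w))
    (wf.min v.1 (hne v)) with h1 | h1 | h1
  · exact absurd h1 (wf.not_lt_min _ (hwv (wf.min_mem _ (hne w))))
  · exact h1
  · exact absurd h1 (wf.not_lt_min _ h)

/-- The test function is the distance from `x`, cut off at `dist x y` to make it bounded. -/
theorem edist_le_spectralDist (τ : ChoiceFunction X) (x y : X) :
    edist x y ≤ spectralDist τ x y := by
  let f : X →ᵇ ℂ := BoundedContinuousFunction.ofNormedAddCommGroup
    (fun z => ((min (dist x z) (dist x y) : ℝ) : ℂ)) (by fun_prop) (dist x y) (fun z => by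
      rw [Complex.norm_real, Real.norm_of_nonneg (le_min dist_nonneg dist_nonneg)]
      exact min_le_right _ _)
  have hf : CommutatorNormLeOne τ f := by
    refine commutatorNormLeOne_of_lipschitz τ fun a b => ?_
    change ‖((min (dist x a) (dist x y) : ℝ) : ℂ) - ((min (dist x b) (dist x y) : ℝ) : ℂ)‖ ≤ _
    rw [← Complex.ofReal_sub, Complex.norm_real, Real.norm_eq_abs]
    refine (abs_min_sub_min_le_max _ _ _ _).trans ?_
    rw [sub_self, abs_zero, max_eq_left (abs_nonneg _), dist_comm x a, dist_comm x b]
    exact abs_dist_sub_le a b x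
  refine le_trans (le_of_eq ?_) (le_iSup₂ (f := fun (g : X →ᵇ ℂ)
    (_ : CommutatorNormLeOne τ g) => ‖g x - g y‖ₑ) f hf)
  change _ = ‖((min (dist x x) (dist x y) : ℝ) : ℂ) - ((min (dist x y) (dist x y) : ℝ) : ℂ)‖ₑ
  rw [dist_self, min_eq_left dist_nonneg, min_self, ← Complex.ofReal_sub, zero_sub,
    ← ofReal_norm, Complex.norm_real, norm_neg, Real.norm_of_nonneg dist_nonneg,
    edist_dist]

/-! ## The upper bound -/

/-- The positive distances from `x` to the points of `X`. -/
def distancesFrom (x : X) : Set ℝ := {t | 0 < t ∧ ∃ y, dist x y = t}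

/-- Only finitely many distances from `x` exceed a given positive number. -/
def LocallyFiniteDistances (X : Type*) [MetricSpace X] : Prop :=
  ∀ (x : X) (ε : ℝ), 0 < ε → (distancesFrom x ∩ Ioi ε).Finite

/-- Distances from `x` cannot accumulate at `s` from below. This makes open balls vertices of the
tree. -/
theorem exists_ball_eq_closedBall (hX : LocallyFiniteDistances X) (x : X) {s : ℝ} (hs : 0 < s) :
    ∃ ρ, 0 < ρ ∧ Metric.ball x s = Metric.closedBall x ρ := by
  have hfin : (distancesFrom x ∩ Ioi (s / 2) ∩ Iio s).Finite :=
    (hX x (s / 2) (by positivity)).subset inter_subset_left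
  obtain ⟨ρ, h1, h2, h3⟩ : ∃ ρ, s / 2 ≤ ρ ∧ ρ < s ∧
      ∀ t ∈ distancesFrom x ∩ Ioi (s / 2) ∩ Iio s, t ≤ ρ := by
    rcases (distancesFrom x ∩ Ioi (s / 2) ∩ Iio s).eq_empty_or_nonempty with he | hne
    · exact ⟨s / 2, le_rfl, by linarith, by simp [he]⟩
    · obtain ⟨m, hm, hmax⟩ := hfin.exists_maximalFor id _ hne
      exact ⟨m, hm.1.2.le, hm.2, fun t ht => (le_total t m).elim id fun h => hmax ht h⟩
  refine ⟨ρ, by linarith, Subset.antisymm (fun z hz => ?_) (Metric.closedBall_subset_ball h2)⟩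
  rw [Metric.mem_ball, dist_comm] at hz
  rw [Metric.mem_closedBall, dist_comm]
  rcases le_or_gt (dist x z) (s / 2) with h | h
  · exact h.trans h1
  · exact h3 _ ⟨⟨⟨by linarith, z, rfl⟩, h⟩, hz⟩

/-- The open ball of radius `s` about `x`, as a vertex of the Michon tree. -/
def ballVertex (hX : LocallyFiniteDistances X) (x : X) {s : ℝ} (hs : 0 < s) : MichonVertex X :=
  ⟨Metric.ball x s, x, exists_ball_eq_closedBall hX x hs⟩

/-- The closed ball of radius `s` about `x`, as a vertex of the Michon tree. -/
def closedBallVertex (x : X) {s : ℝ} (hs : 0 < s) : MichonVertex X :=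
  ⟨Metric.closedBall x s, x, s, hs, rfl⟩

variable [IsUltrametricDist X]

/-- The point `y` makes the inclusion strict. A closed ball in between may be recentred at `x`; its
radius is either below `s` or at least `s`, so nothing fits strictly between. -/
theorem ballVertex_covBy (hX : LocallyFiniteDistances X) {x y : X} {s : ℝ} (hs : 0 < s)
    (hxy : dist x y = s) : ballVertex hX x hs ⋖ closedBallVertex x hs := by
  have hle : ballVertex hX x hs ≤ closedBallVertex x hs := Metric.ball_subset_closedBall
  refine ⟨lt_of_le_not_ge hle fun h => ?_, ?_⟩
  · have h1 : y ∈ Metric.ball x s := h (by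
      change y ∈ Metric.closedBall x s
      rw [Metric.mem_closedBall, dist_comm, hxy])
    rw [Metric.mem_ball, dist_comm, hxy] at h1
    exact lt_irrefl _ h1
  · rintro ⟨w, z, ρ, hρ, rfl⟩ h1 h2
    have hx : x ∈ Metric.closedBall z ρ := h1.le (Metric.mem_ball_self hs)
    have hw : Metric.closedBall z ρ = Metric.closedBall x ρ :=
      (IsUltrametricDist.closedBall_eq_of_mem hx)
    rcases lt_or_ge ρ s with h | h
    · refine h1.not_ge ?_
      change Metric.closedBall z ρ ⊆ Metric.ball x s
      rw [hw]
      exact Metric.closedBall_subset_ball h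
    · refine h2.not_ge ?_
      change Metric.closedBall x s ⊆ Metric.closedBall z ρ
      rw [hw]
      exact Metric.closedBall_subset_closedBall h

theorem norm_sub_ballVertex_le (hX : LocallyFiniteDistances X) {τ : ChoiceFunction X}
    {f : X →ᵇ ℂ} (hf : CommutatorNormLeOne τ f) {x y : X} {s : ℝ} (hs : 0 < s)
    (hxy : dist x y = s) :
    ‖f (τ.toFun (ballVertex hX x hs)) - f (τ.toFun (ballVertex hX y hs))‖ ≤ s := by
  have hyx : dist y x = s := by rw [dist_comm, hxy]
  have hcl : closedBallVertex y hs = closedBallVertex x hs := Subtype.ext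
    (IsUltrametricDist.closedBall_eq_of_mem (by
      rw [Metric.mem_closedBall, hxy]))
  have hne : ballVertex hX x hs ≠ ballVertex hX y hs := by
    intro h
    have h1 : y ∈ Metric.ball x s := by
      rw [show Metric.ball x s = Metric.ball y s from congrArg Subtype.val h]
      exact Metric.mem_ball_self hs
    rw [Metric.mem_ball, hyx] at h1
    exact lt_irrefl _ h1
  have he := norm_sub_le_of_commutatorNormLeOne hf
    ⟨(τ.toFun (ballVertex hX x hs), τ.toFun (ballVertex hX y hs)), closedBallVertex x hs, _, _,
      ballVertex_covBy hX hs hxy, hcl ▸ ballVertex_covBy hX hs hyx, hne, rfl⟩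
  refine he.trans ?_
  have h1 : dist (τ.toFun (ballVertex hX x hs)) x < s := τ.mem (ballVertex hX x hs)
  have h2 : dist (τ.toFun (ballVertex hX y hs)) y < s := τ.mem (ballVertex hX y hs)
  refine (dist_triangle_max _ x _).trans (max_le h1.le ?_)
  refine (dist_triangle_max _ y _).trans (max_le hxy.le ?_)
  rw [dist_comm]
  exact h2.le

/-- Let `z` be the point chosen in the closed ball. Either `z` lies in the open ball about `x` and
is chosen there too, or the open ball about `z` is a sibling whose chosen point is `z`, and one edge
suffices. -/
theorem norm_sub_closedBallVertex_le (hX : LocallyFiniteDistances X) {τ : ChoiceFunction X}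
    {f : X →ᵇ ℂ} (hf : CommutatorNormLeOne τ f) (x : X) {s : ℝ} (hs : 0 < s) :
    ‖f (τ.toFun (ballVertex hX x hs)) - f (τ.toFun (closedBallVertex x hs))‖ ≤ s := by
  set z := τ.toFun (closedBallVertex x hs) with hz
  have hzs : dist z x ≤ s := τ.mem (closedBallVertex x hs)
  rcases hzs.lt_or_eq with h | h
  · rw [τ.coherent (closedBallVertex x hs) (ballVertex hX x hs) Metric.ball_subset_closedBall h,
      ← hz, sub_self, norm_zero]
    exact hs.le
  · have h1 : τ.toFun (ballVertex hX z hs) = z := by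
      refine τ.coherent (closedBallVertex x hs) (ballVertex hX z hs) ?_
        (Metric.mem_ball_self hs)
      change Metric.ball z s ⊆ Metric.closedBall x s
      rw [IsUltrametricDist.closedBall_eq_of_mem (show z ∈ Metric.closedBall x s from hzs)]
      exact Metric.ball_subset_closedBall
    have h2 := norm_sub_ballVertex_le hX hf hs ((dist_comm x z).trans h)
    rwa [h1] at h2

/-- Descending from the open ball of radius `s` to the closed ball of radius `ρ`, the values of `f`
at the chosen points vary by at most the sum of the distances from `x` passed on the way. -/
theorem norm_sub_le_sum_distances (hX : LocallyFiniteDistances X) {τ : ChoiceFunction X}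
    {f : X →ᵇ ℂ} (hf : CommutatorNormLeOne τ f) (x : X) {ρ : ℝ} (hρ : 0 < ρ) (F : Finset ℝ) :
    ∀ {s : ℝ} (hs : 0 < s), ρ < s → (F : Set ℝ) = distancesFrom x ∩ Ioo ρ s →
      ‖f (τ.toFun (ballVertex hX x hs)) - f (τ.toFun (closedBallVertex x hρ))‖ ≤
        ∑ t ∈ F, t := by
  induction F using Finset.induction_on_max with
  | empty =>
    intro s hs hρs hF
    have h : ballVertex hX x hs = closedBallVertex x hρ := by
      refine Subtype.ext (Subset.antisymm (fun z hz => ?_) (Metric.closedBall_subset_ball hρs))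
      by_contra hz'
      have hzs : dist x z < s := by rw [dist_comm]; exact hz
      have hzρ : ρ < dist x z := by rw [dist_comm]; exact not_le.1 hz'
      have : dist x z ∈ ((∅ : Finset ℝ) : Set ℝ) := by
        rw [hF]; exact ⟨⟨hρ.trans hzρ, z, rfl⟩, hzρ, hzs⟩
      simp at this
    simp [h]
  | insert t F hmax ih =>
    intro s hs hρs hF
    have htF : t ∈ distancesFrom x ∩ Ioo ρ s := by rw [← hF]; simp
    obtain ⟨⟨ht, -⟩, hρt, hts⟩ := htF
    -- Since `t` is the largest distance below `s`, there is nothing to pass until radius `t`.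
    have h1 : ballVertex hX x hs = closedBallVertex x ht := by
      refine Subtype.ext (Subset.antisymm (fun z hz => ?_) (Metric.closedBall_subset_ball hts))
      by_contra hz'
      have hzs : dist x z < s := by rw [dist_comm]; exact hz
      have hzt : t < dist x z := by rw [dist_comm]; exact not_le.1 hz'
      have : dist x z ∈ ((insert t F : Finset ℝ) : Set ℝ) := by
        rw [hF]; exact ⟨⟨ht.trans hzt, z, rfl⟩, hρt.trans hzt, hzs⟩
      rcases Finset.mem_insert.1 (Finset.mem_coe.1 this) with h | h
      · exact hzt.ne' h
      · exact (hmax _ h).not_gt hzt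
    have h2 : (F : Set ℝ) = distancesFrom x ∩ Ioo ρ t := by
      ext a
      constructor
      · intro ha
        have : a ∈ distancesFrom x ∩ Ioo ρ s := by
          rw [← hF]; exact Finset.mem_coe.2 (Finset.mem_insert_of_mem ha)
        exact ⟨this.1, this.2.1, hmax a ha⟩
      · rintro ⟨ha, ha1, ha2⟩
        have : a ∈ ((insert t F : Finset ℝ) : Set ℝ) := by
          rw [hF]; exact ⟨ha, ha1, ha2.trans hts⟩
        exact (Finset.mem_insert.1 (Finset.mem_coe.1 this)).resolve_left ha2.ne
    rw [Finset.sum_insert fun h => lt_irrefl _ (hmax t h), h1]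
    refine (norm_sub_le_norm_sub_add_norm_sub _ (f (τ.toFun (ballVertex hX x ht))) _).trans ?_
    refine add_le_add ?_ (ih ht hρt h2)
    rw [norm_sub_rev]
    exact norm_sub_closedBallVertex_le hX hf x ht

theorem norm_sub_ballVertex_self_le (hX : LocallyFiniteDistances X) {τ : ChoiceFunction X}
    {f : X →ᵇ ℂ} (hf : CommutatorNormLeOne τ f) (x : X) {s M : ℝ} (hs : 0 < s)
    (hM : ∀ F : Finset ℝ, (F : Set ℝ) ⊆ distancesFrom x ∩ Iio s → ∑ t ∈ F, t ≤ M) :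
    ‖f (τ.toFun (ballVertex hX x hs)) - f x‖ ≤ M := by
  refine le_of_forall_pos_le_add fun ε hε => ?_
  -- By continuity the descent may stop at a ball so small that `f` at its chosen point is within
  -- `ε` of `f x`.
  obtain ⟨η, hη, hfη⟩ := Metric.continuousAt_iff.1 f.continuous.continuousAt ε hε
  have hρ : 0 < min (η / 2) (s / 2) := by positivity
  have hρs : min (η / 2) (s / 2) < s := (min_le_right _ _).trans_lt (by linarith)
  have hfin : (distancesFrom x ∩ Ioo (min (η / 2) (s / 2)) s).Finite :=
    (hX x _ hρ).subset fun t ht => ⟨ht.1, ht.2.1⟩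
  have h1 := norm_sub_le_sum_distances hX hf x hρ hfin.toFinset hs hρs hfin.coe_toFinset
  have h2 := hM hfin.toFinset (by
    rw [hfin.coe_toFinset]
    exact fun t ht => ⟨ht.1, ht.2.2⟩)
  have h3 : dist (τ.toFun (closedBallVertex x hρ)) x ≤ min (η / 2) (s / 2) :=
    τ.mem (closedBallVertex x hρ)
  have h4 := hfη (h3.trans_lt ((min_le_left _ _).trans_lt (by linarith)))
  rw [dist_eq_norm] at h4
  exact (norm_sub_le_norm_sub_add_norm_sub _ _ _).trans (add_le_add (h1.trans h2) h4.le)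

theorem spectralDist_le (hX : LocallyFiniteDistances X) {K : ℝ≥0}
    (hK : ∀ (x : X), ∀ s ∈ distancesFrom x, ∀ F : Finset ℝ,
      (F : Set ℝ) ⊆ distancesFrom x ∩ Iio s → ∑ t ∈ F, t ≤ K * s)
    (τ : ChoiceFunction X) (x y : X) :
    spectralDist τ x y ≤ ((1 + 2 * K : ℝ≥0) : ℝ≥0∞) * edist x y := by
  refine iSup₂_le fun f hf => ?_
  rcases eq_or_ne x y with rfl | hxy
  · simp
  have hs : 0 < dist x y := dist_pos.2 hxy
  have h1 := norm_sub_ballVertex_self_le hX hf x hs (hK x _ ⟨hs, y, rfl⟩)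
  have h2 := norm_sub_ballVertex_self_le hX hf y hs (hK y _ ⟨hs, x, dist_comm y x⟩)
  have h3 := norm_sub_ballVertex_le hX hf hs rfl
  have h4 : ‖f x - f y‖ ≤ ((1 + 2 * K : ℝ≥0) : ℝ) * dist x y := by
    rw [norm_sub_rev] at h1
    refine (norm_sub_le_norm_sub_add_norm_sub _ (f (τ.toFun (ballVertex hX x hs))) _).trans ?_
    have h5 := norm_sub_le_norm_sub_add_norm_sub (f (τ.toFun (ballVertex hX x hs)))
      (f (τ.toFun (ballVertex hX y hs))) (f y)
    push_cast
    linarith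
  rw [← ofReal_norm, edist_dist, ← ENNReal.ofReal_coe_nnreal,
    ← ENNReal.ofReal_mul NNReal.zero_le_coe]
  exact ENNReal.ofReal_le_ofReal h4

end Spectral

/-! ## Counting patches -/

section Counting

variable {d : ℕ} {L : Type*} {T : Set (MarkedSet d L)} {δ : DecayFunction}

theorem translate_zero (T : Set (MarkedSet d L)) : translate T 0 = T := by
  have : (fun t : MarkedSet d L => t.sub 0) = id := by
    funext t
    ext <;> simp [MarkedSet.sub]
  rw [translate, this, image_id]

theorem centralPatch_mem_patches (ξ : DiscreteTilingSpace T δ) {r : ℝ} (hr : 0 < r) :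
    centralPatch r ξ.1 ∈ patches T r := by
  rw [← ξ.2.2.1 r hr]
  exact ⟨0, ξ.2.2.2, by rw [translate_zero]⟩

theorem centralPatch_eq_of_dist_lt {ξ η : DiscreteTilingSpace T δ} {r : ℝ} (hr : 0 < r)
    (h : dist ξ η < δ r) : centralPatch r ξ.1 = centralPatch r η.1 := by
  obtain ⟨_, ⟨s, hs, rfl⟩, hs'⟩ := exists_lt_of_csInf_lt (nonempty_coincidence δ ξ.1 η.1) h
  have hrs : r < s := (δ.strictAntiOn.lt_iff_gt (coincidenceRadii_nonneg hs) hr.le).1 hs'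
  rcases hs with rfl | ⟨_, hs⟩
  · exact absurd hrs (not_lt.2 hr.le)
  · exact centralPatch_eq_of_le hrs.le hs

theorem dist_le_of_centralPatch_eq {ξ η : DiscreteTilingSpace T δ} {r : ℝ} (hr : 0 < r)
    (h : centralPatch r ξ.1 = centralPatch r η.1) : dist ξ η ≤ δ r :=
  csInf_le (bddBelow_coincidence δ ξ.1 η.1) ⟨r, Or.inr ⟨hr, h⟩, rfl⟩

/-- Points at different distances from `ξ`, all larger than `δ r`, have different `r`-patches. -/
theorem centralPatch_ne_of_dist_ne {ξ η ζ : DiscreteTilingSpace T δ} {r : ℝ} (hr : 0 < r)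
    (hη : δ r < dist ξ η) (hne : dist ξ η ≠ dist ξ ζ) :
    centralPatch r η.1 ≠ centralPatch r ζ.1 := by
  intro h
  have h1 := dist_le_of_centralPatch_eq hr h
  have h2 := dist_triangle_max ξ ζ η
  have h3 := dist_triangle_max ξ η ζ
  rw [dist_comm ζ η] at h2
  have h4 : dist ξ η ≤ dist ξ ζ := by
    rcases le_max_iff.1 h2 with h | h
    · exact h
    · exact absurd (h.trans h1) (not_le.2 hη)
  rw [max_eq_left (h1.trans hη.le)] at h3
  exact hne (le_antisymm h4 h3)

/-- For each distance `t` from `ξ`, `p t` is the `b`-patch of some point at distance `t`. Counting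
distances thus becomes counting patches. -/
theorem exists_patches_of_distances (ξ : DiscreteTilingSpace T δ) {b : ℝ} (hb : 0 < b) :
    ∃ p : ℝ → Set (MarkedSet d L), InjOn p (distancesFrom ξ ∩ Ioi (δ b)) ∧
      ∀ t ∈ distancesFrom ξ, p t ∈ patches T b ∧
        ∀ a, 0 < a → a ≤ b → t < δ a → centralPatch a (p t) = centralPatch a ξ.1 := by
  have : Nonempty (DiscreteTilingSpace T δ) := ⟨ξ⟩
  choose! y hy using fun t (ht : t ∈ distancesFrom ξ) => ht.2
  refine ⟨fun t => centralPatch b (y t).1, fun t ht t' ht' h => ?_, fun t ht => ⟨?_, ?_⟩⟩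
  · by_contra hne
    exact centralPatch_ne_of_dist_ne (ξ := ξ) hb (by rw [hy t ht.1]; exact ht.2)
      (by rwa [hy t ht.1, hy t' ht'.1]) h
  · exact centralPatch_mem_patches _ hb
  · intro a ha hab hta
    rw [centralPatch_eq_of_dist_lt ha ((hy t ht).trans_lt hta)]
    ext u
    exact ⟨fun h => ⟨h.1.1, h.2⟩, fun h => ⟨⟨h.1, h.2.trans hab⟩, h.2⟩⟩

theorem card_distances_le_patchCount (hFLC : FiniteLocalComplexity T)
    (ξ : DiscreteTilingSpace T δ) {b : ℝ} (hb : 0 < b) {F : Finset ℝ}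
    (hF : (F : Set ℝ) ⊆ distancesFrom ξ ∩ Ioi (δ b)) : F.card ≤ patchCount T b := by
  obtain ⟨p, hinj, hp⟩ := exists_patches_of_distances ξ hb
  rw [← ncard_coe_finset F]
  exact ncard_le_ncard_of_injOn p (fun t ht => (hp t (hF ht).1).1) (hinj.mono hF) (hFLC b hb)

theorem locallyFiniteDistances (hFLC : FiniteLocalComplexity T) :
    LocallyFiniteDistances (DiscreteTilingSpace T δ) := by
  intro ξ ε hε
  obtain ⟨b, hb, hbε⟩ := ((eventually_gt_atTop (0 : ℝ)).and
    (δ.tendsto_zero.eventually_lt_const hε)).exists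
  obtain ⟨p, hinj, hp⟩ := exists_patches_of_distances ξ hb
  have hsub : distancesFrom ξ ∩ Ioi ε ⊆ distancesFrom ξ ∩ Ioi (δ b) :=
    inter_subset_inter_right _ (Ioi_subset_Ioi hbε.le)
  refine Finite.of_finite_image ((hFLC b hb).subset ?_) (hinj.mono hsub)
  rintro _ ⟨t, ht, rfl⟩
  exact (hp t ht.1).1

theorem cube_mono {m n : ℕ} (h : m ≤ n) : cube d m ⊆ cube d n := by
  intro y hy i
  refine (hy i).trans ?_
  gcongr

/-- A patch with non-zero frequency occurs finitely often in each cube. -/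
theorem HasFrequency.finite_occurrences {r φ : ℝ} {p : Set (MarkedSet d L)}
    (h : HasFrequency T r p φ) (hφ : φ ≠ 0) (n : ℕ) : (occurrences T r p ∩ cube d n).Finite := by
  by_contra hinf
  -- Infinite sets have `ncard` 0, so infinitely many occurrences in one cube would make the counts
  -- in all larger cubes, and hence the frequency, vanish.
  refine hφ (tendsto_nhds_unique h (tendsto_const_nhds.congr' ?_))
  filter_upwards [eventually_ge_atTop n] with m hm
  have : (occurrences T r p ∩ cube d m).Infinite :=
    Infinite.mono (inter_subset_inter_right _ (cube_mono hm)) hinf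
  rw [this.ncard, Nat.cast_zero, zero_div]

/-- The frequencies of distinct patches extending a given one add up to at most its frequency. -/
theorem sum_frequency_le {a b φ : ℝ} {q : Set (MarkedSet d L)} (hab : a ≤ b)
    (hq : HasFrequency T a q φ) (hφ : φ ≠ 0) {ι : Type*} {F : Finset ι}
    {p : ι → Set (MarkedSet d L)} {ψ : ι → ℝ} (hinj : InjOn p F)
    (hpq : ∀ t ∈ F, centralPatch a (p t) = q) (hp : ∀ t ∈ F, HasFrequency T b (p t) (ψ t)) :
    ∑ t ∈ F, ψ t ≤ φ := by
  refine le_of_tendsto_of_tendsto (tendsto_finsetSum F hp) hq (Eventually.of_forall fun n => ?_)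
  have hsub : ∀ t ∈ F, occurrences T b (p t) ∩ cube d n ⊆ occurrences T a q ∩ cube d n := by
    rintro t ht x ⟨⟨hx, hxp⟩, hxn⟩
    refine ⟨⟨hx, ?_⟩, hxn⟩
    rw [← hpq t ht, ← hxp]
    ext u
    exact ⟨fun h => ⟨⟨h.1, h.2.trans hab⟩, h.2⟩, fun h => ⟨h.1.1, h.2⟩⟩
  have hfin := hq.finite_occurrences hφ n
  have hcard : ∑ t ∈ F, (occurrences T b (p t) ∩ cube d n).ncard ≤
      (occurrences T a q ∩ cube d n).ncard := by
    classical
    rw [← finsum_mem_coe_finset, ← Set.Finite.ncard_biUnion F.finite_toSet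
      (fun t ht => hfin.subset (hsub t ht))]
    · exact ncard_le_ncard (iUnion₂_subset hsub) hfin
    · intro t ht t' ht' hne
      refine disjoint_left.2 fun x hx hx' => hne (hinj ht ht' ?_)
      rw [← hx.1.2, ← hx'.1.2]
  beta_reduce
  rw [← Finset.sum_div]
  gcongr
  exact_mod_cast hcard

theorem patchCount_pos (hFLC : FiniteLocalComplexity T) (ξ : DiscreteTilingSpace T δ) {r : ℝ}
    (hr : 0 < r) : 0 < patchCount T r :=
  (ncard_pos (hFLC r hr)).2 ⟨_, centralPatch_mem_patches ξ hr⟩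

/-- Each patch extending the `a`-patch of `ξ` has frequency at least `c / P(b)`, and together they
have at most `C / P(a)`; hence the constant `C / c`. -/
theorem exists_card_distances_le (hFLC : FiniteLocalComplexity T)
    (hfreq : EquidistributedFrequencies T) :
    ∃ K : ℝ, 0 ≤ K ∧ ∀ (ξ : DiscreteTilingSpace T δ) (a b : ℝ), 0 < a → a ≤ b → ∀ F : Finset ℝ,
      (F : Set ℝ) ⊆ distancesFrom ξ ∩ Ioo (δ b) (δ a) →
        (F.card : ℝ) * patchCount T a ≤ K * patchCount T b := by
  obtain ⟨c, C, hc, hC, h⟩ := hfreq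
  refine ⟨C / c, by positivity, fun ξ a b ha hab F hF => ?_⟩
  have hb : 0 < b := ha.trans_le hab
  obtain ⟨p, hinj, hp⟩ := exists_patches_of_distances ξ hb
  have hPa : (0 : ℝ) < patchCount T a := Nat.cast_pos.2 (patchCount_pos hFLC ξ ha)
  have hPb : (0 : ℝ) < patchCount T b := Nat.cast_pos.2 (patchCount_pos hFLC ξ hb)
  obtain ⟨φ, hφ, hφc, hφC⟩ := h a ha _ (centralPatch_mem_patches ξ ha)
  have hφ0 : 0 < φ := lt_of_lt_of_le (by positivity) hφc
  choose! ψ hψ hψc _ using h b hb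
  have h1 : ∑ t ∈ F, ψ (p t) ≤ φ := by
    refine sum_frequency_le hab hφ hφ0.ne' (p := p) (hinj.mono fun t ht => ?_)
      (fun t ht => ?_) (fun t ht => ?_)
    · exact ⟨(hF ht).1, (hF ht).2.1⟩
    · exact (hp t (hF ht).1).2 a ha hab (hF ht).2.2
    · exact hψ _ (hp t (hF ht).1).1
  have h2 : F.card • (c * (patchCount T b : ℝ)⁻¹) ≤ ∑ t ∈ F, ψ (p t) :=
    Finset.card_nsmul_le_sum _ _ _ fun t ht => hψc _ (hp t (hF ht).1).1
  have h3 := (h2.trans h1).trans hφC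
  rw [nsmul_eq_mul] at h3
  field_simp at h3 ⊢
  linarith

end Counting

/-! ## Summation over geometric levels -/

theorem DecayFunction.lt_of_lt (δ : DecayFunction) {a b : ℝ} (ha : 0 ≤ a) (hab : a < b) :
    δ b < δ a := δ.strictAntiOn ha (ha.trans hab.le) hab

theorem DecayFunction.le_of_le (δ : DecayFunction) {a b : ℝ} (ha : 0 ≤ a) (hab : a ≤ b) :
    δ b ≤ δ a := δ.strictAntiOn.antitoneOn ha (ha.trans hab) hab

theorem DecayFunction.summable_four_pow (δ : DecayFunction)
    (h : IntegrableOn (fun x : ℝ => δ x / x) (Ici 1) volume) :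
    Summable fun m : ℕ => δ (4 ^ m) := by
  rw [← summable_nat_add_iff 1]
  have h1 : ∀ m : ℕ, (1 : ℝ) ≤ 4 ^ m := fun m => one_le_pow₀ (by norm_num)
  have hle : ∀ m : ℕ, (4 : ℝ) ^ m ≤ 4 ^ (m + 1) := fun m =>
    pow_le_pow_right₀ (by norm_num) (Nat.le_succ m)
  have hsub : ∀ m : ℕ, Ioc ((4 : ℝ) ^ m) (4 ^ (m + 1)) ⊆ Ici 1 := fun m x hx =>
    (h1 m).trans hx.1.le
  have hint : ∀ m : ℕ, IntervalIntegrable (fun x : ℝ => δ x / x) volume (4 ^ m) (4 ^ (m + 1)) :=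
    fun m => (intervalIntegrable_iff_integrableOn_Ioc_of_le (hle m)).2 (h.mono_set (hsub m))
  have hnn : ∀ x ∈ Ici (1 : ℝ), 0 ≤ δ x / x := fun x hx =>
    div_nonneg (δ.pos (zero_le_one.trans hx)).le (zero_le_one.trans hx)
  -- On an interval of length `3 * 4 ^ m` the integrand is at least `δ (4 ^ (m + 1)) / 4 ^ (m + 1)`.
  have hterm : ∀ m : ℕ, 3 / 4 * δ (4 ^ (m + 1)) ≤ ∫ x in (4 : ℝ) ^ m..4 ^ (m + 1), δ x / x := by
    intro m
    have h0 : (0 : ℝ) < 4 ^ m := by positivity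
    have h2 := intervalIntegral.integral_mono_on (hle m)
      (intervalIntegrable_const (c := δ (4 ^ (m + 1)) / 4 ^ (m + 1))) (hint m) (fun x hx => by
        have hx0 : 0 < x := h0.trans_le hx.1
        exact div_le_div₀ (δ.pos hx0.le).le (δ.le_of_le hx0.le hx.2) hx0 hx.2)
    refine le_of_eq_of_le ?_ h2
    rw [intervalIntegral.integral_const, smul_eq_mul, pow_succ]
    field_simp
    ring
  have hsum : ∀ n : ℕ, ∑ m ∈ Finset.range n, 3 / 4 * δ (4 ^ (m + 1)) ≤
      ∫ x in Ici (1 : ℝ), δ x / x := by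
    intro n
    refine (Finset.sum_le_sum fun m _ => hterm m).trans ?_
    rw [intervalIntegral.sum_integral_adjacent_intervals (a := fun m : ℕ => (4 : ℝ) ^ m)
      (fun k _ => hint k), pow_zero, intervalIntegral.integral_of_le (h1 n)]
    refine setIntegral_mono_set h ?_
      (LE.le.eventuallyLE (show Ioc _ _ ⊆ Ici (1 : ℝ) from fun x hx => hx.1.le))
    exact (ae_restrict_mem measurableSet_Ici).mono fun x hx => hnn x hx
  have h3 := summable_of_sum_range_le (fun m => by
    have := δ.pos (r := 4 ^ (m + 1)) (by positivity)
    positivity) hsum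
  exact (summable_mul_left_iff (by norm_num)).1 h3

theorem DecayFunction.exists_summable_bound (δ : DecayFunction)
    (h : IntegrableOn (fun x : ℝ => δ x / x) (Ici 1) volume) {R : ℝ} (hR : 1 ≤ R)
    (hsub : ∀ a r : ℝ, R ≤ a → R ≤ r → δ (a * r) ≤ δ a * δ r) :
    ∃ K : ℝ, 0 ≤ K ∧ ∀ x : ℝ, R ≤ x → ∀ N : ℕ, ∑ m ∈ Finset.range N, δ (4 ^ m * x) ≤ K * δ x := by
  obtain ⟨M, hM⟩ := pow_unbounded_of_one_lt R (show (1 : ℝ) < 4 by norm_num)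
  have hs := δ.summable_four_pow h
  have hpos : ∀ m : ℕ, 0 ≤ δ (4 ^ m) := fun m => (δ.pos (by positivity)).le
  -- Submultiplicativity needs `4 ^ m ≥ R`; the `M` earlier terms are each at most `δ x` by
  -- monotonicity.
  refine ⟨M + ∑' m : ℕ, δ (4 ^ m), add_nonneg M.cast_nonneg (tsum_nonneg hpos), fun x hx N => ?_⟩
  have hx0 : 0 < δ x := δ.pos (by linarith)
  have hterm : ∀ m : ℕ, δ (4 ^ m * x) ≤ ((if m < M then 1 else 0) + δ (4 ^ m)) * δ x := by
    intro m
    split_ifs with hm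
    · rw [add_mul, one_mul]
      refine le_add_of_le_of_nonneg (δ.le_of_le (by linarith) ?_) (mul_nonneg (hpos m) hx0.le)
      exact le_mul_of_one_le_left (by linarith) (one_le_pow₀ (by norm_num))
    · rw [zero_add]
      exact hsub _ _ (hM.le.trans (pow_le_pow_right₀ (by norm_num) (not_lt.1 hm))) hx
  refine (Finset.sum_le_sum fun m _ => hterm m).trans ?_
  rw [← Finset.sum_mul, Finset.sum_add_distrib]
  gcongr
  · rw [Finset.sum_ite, Finset.sum_const_zero, add_zero, Finset.sum_const, nsmul_eq_mul, mul_one]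
    exact_mod_cast (Finset.card_le_card (t := Finset.range M) fun m hm => by
      simpa using (Finset.mem_filter.1 hm).2).trans_eq (Finset.card_range M)
  · exact hs.sum_le_tsum _ fun m _ => hpos m

/-- If a set of reals has at most `K` elements between consecutive levels `D n`, then its elements
between the levels `D (n + N)` and `D n` add up to at most `K` times the sum of these levels. -/
theorem sum_le_of_card_levels_le {D : ℕ → ℝ} (hD : ∀ n, 0 ≤ D n) {S : Set ℝ} {K : ℝ}
    (hK : ∀ n, ∀ F : Finset ℝ, (F : Set ℝ) ⊆ S ∩ Ico (D (n + 1)) (D n) → (F.card : ℝ) ≤ K)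
    (n N : ℕ) (F : Finset ℝ) (hF : (F : Set ℝ) ⊆ S ∩ Ico (D (n + N)) (D n)) :
    ∑ t ∈ F, t ≤ K * ∑ m ∈ Finset.range N, D (n + m) := by
  induction N generalizing F with
  | zero =>
    have : F = ∅ := by
      ext t
      simp only [Finset.notMem_empty, iff_false]
      intro ht
      exact (hF ht).2.2.not_ge (hF ht).2.1
    simp [this]
  | succ N ih =>
    rw [← Finset.sum_filter_add_sum_filter_not F (fun t => D (n + N) ≤ t), Finset.sum_range_succ,
      mul_add]
    refine add_le_add (ih _ ?_) ?_
    · intro t ht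
      obtain ⟨ht, ht'⟩ := Finset.mem_filter.1 (Finset.mem_coe.1 ht)
      exact ⟨(hF ht).1, ht', (hF ht).2.2⟩
    · have h1 : ∀ t ∈ F.filter (fun t => ¬ D (n + N) ≤ t), t ≤ D (n + N) := fun t ht =>
        (not_le.1 (Finset.mem_filter.1 ht).2).le
      refine (Finset.sum_le_card_nsmul _ _ _ h1).trans ?_
      rw [nsmul_eq_mul]
      refine mul_le_mul_of_nonneg_right (hK (n + N) _ fun t ht => ?_) (hD _)
      obtain ⟨ht, ht'⟩ := Finset.mem_filter.1 (Finset.mem_coe.1 ht)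
      exact ⟨(hF ht).1, (hF ht).2.1, not_le.1 ht'⟩

theorem sum_le_mul_of_levels {D : ℕ → ℝ} (hD : ∀ n, 0 < D n) (hD0 : Tendsto D atTop (𝓝 0))
    {S : Set ℝ} (hS : ∀ t ∈ S, 0 < t) {K K' : ℝ}
    (hKn : ∀ n, ∀ F : Finset ℝ, (F : Set ℝ) ⊆ S ∩ Ico (D (n + 1)) (D n) → (F.card : ℝ) ≤ K)
    (hKtop : ∀ F : Finset ℝ, (F : Set ℝ) ⊆ S ∩ Ici (D 0) → (F.card : ℝ) ≤ K)
    (hK' : ∀ n N, ∑ m ∈ Finset.range N, D (n + m) ≤ K' * D n) {s : ℝ} (hs : 0 < s)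
    (F : Finset ℝ) (hF : (F : Set ℝ) ⊆ S ∩ Iio s) : ∑ t ∈ F, t ≤ K * (1 + K') * s := by
  have hK0 : 0 ≤ K := by simpa using hKtop ∅ (by simp)
  have hK'0 : 0 ≤ K' := by
    have := hK' 0 0
    rw [Finset.sum_range_zero] at this
    exact nonneg_of_mul_nonneg_left this (hD 0)
  -- Take the first level not above `s`. At most `K` elements lie between it and `s`, contributing
  -- `K * s`; those below it contribute at most `K * K' * D n ≤ K * K' * s`.
  obtain ⟨n, hns, hcard⟩ : ∃ n, D n ≤ s ∧
      ∀ G : Finset ℝ, (G : Set ℝ) ⊆ S ∩ Ico (D n) s → (G.card : ℝ) ≤ K := by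
    have hex : ∃ n, D n ≤ s := ((hD0.eventually_lt_const hs).exists).imp fun _ h => h.le
    classical
    refine ⟨Nat.find hex, Nat.find_spec hex, fun G hG => ?_⟩
    rcases h : Nat.find hex with _ | k
    · rw [h] at hG
      exact hKtop G fun t ht => ⟨(hG ht).1, (hG ht).2.1⟩
    · rw [h] at hG
      have hk : s < D k := not_le.1 (Nat.find_min hex (by omega))
      exact hKn k G fun t ht => ⟨(hG ht).1, (hG ht).2.1, (hG ht).2.2.trans hk⟩
  obtain ⟨N, hN⟩ : ∃ N, ∀ t ∈ F, D (n + N) ≤ t := by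
    have h1 : ∀ᶠ m in atTop, ∀ t ∈ F, D m ≤ t := by
      rw [Filter.eventually_all_finset]
      exact fun t ht => (hD0.eventually_lt_const (hS t (hF ht).1)).mono fun _ h => h.le
    obtain ⟨m, hm⟩ := h1.exists_forall_of_atTop
    exact ⟨m, hm _ (Nat.le_add_left m n)⟩
  rw [← Finset.sum_filter_add_sum_filter_not F (fun t => D n ≤ t),
    show K * (1 + K') * s = K * s + K * (K' * s) by ring]
  refine add_le_add ?_ ?_
  · refine (Finset.sum_le_card_nsmul _ _ s fun t ht =>
      (hF (Finset.mem_filter.1 ht).1).2.le).trans ?_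
    rw [nsmul_eq_mul]
    refine mul_le_mul_of_nonneg_right (hcard _ fun t ht => ?_) hs.le
    obtain ⟨ht, ht'⟩ := Finset.mem_filter.1 (Finset.mem_coe.1 ht)
    exact ⟨(hF ht).1, ht', (hF ht).2⟩
  · refine (sum_le_of_card_levels_le (fun n => (hD n).le) hKn n N _ fun t ht => ?_).trans ?_
    · obtain ⟨ht, ht'⟩ := Finset.mem_filter.1 (Finset.mem_coe.1 ht)
      exact ⟨(hF ht).1, hN t ht, not_le.1 ht'⟩
    · exact mul_le_mul_of_nonneg_left
        ((hK' n N).trans (mul_le_mul_of_nonneg_left hns hK'0)) hK0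

/-! ### The uniform bound on sums of distances in the tiling space -/

section Tilings

variable {d : ℕ} {L : Type*} {T : Set (MarkedSet d L)} {δ : DecayFunction}

theorem exists_sum_distances_le (hFLC : FiniteLocalComplexity T)
    (hfreq : EquidistributedFrequencies T)
    (hP : ∃ c : ℝ, ∀ᶠ r : ℝ in atTop, (patchCount T (4 * r) : ℝ) ≤ c * (patchCount T r : ℝ))
    (hδ_sub : ∃ R : ℝ, ∀ a r : ℝ, R ≤ a → R ≤ r → δ (a * r) ≤ δ a * δ r)
    (hδ_int : IntegrableOn (fun x : ℝ => δ x / x) (Ici 1) volume) :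
    ∃ K : ℝ≥0, ∀ (ξ : DiscreteTilingSpace T δ), ∀ s ∈ distancesFrom ξ, ∀ F : Finset ℝ,
      (F : Set ℝ) ⊆ distancesFrom ξ ∩ Iio s → ∑ t ∈ F, t ≤ K * s := by
  obtain ⟨c, hP⟩ := hP
  obtain ⟨R₁, hR₁⟩ := eventually_atTop.1 hP
  obtain ⟨R₂, hR₂⟩ := hδ_sub
  obtain ⟨R, hR, h1R, h2R⟩ : ∃ R : ℝ, 1 ≤ R ∧ R₁ ≤ R ∧ R₂ ≤ R :=
    ⟨max 1 (max R₁ R₂), le_max_left _ _, (le_max_left _ _).trans (le_max_right _ _),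
      (le_max_right _ _).trans (le_max_right _ _)⟩
  obtain ⟨K', hK'0, hK'⟩ := δ.exists_summable_bound hδ_int hR fun a r ha hr =>
    hR₂ a r (h2R.trans ha) (h2R.trans hr)
  obtain ⟨K₁, hK₁0, hK₁⟩ := exists_card_distances_le (δ := δ) hFLC hfreq
  have hx : ∀ n : ℕ, R ≤ 4 ^ n * R := fun n =>
    le_mul_of_one_le_left (by linarith) (one_le_pow₀ (by norm_num))
  have hsucc : ∀ n : ℕ, (4 : ℝ) ^ (n + 1) * R = 4 * (4 ^ n * R) := fun n => by ring
  -- The first entry serves the gaps between levels, the second the distances of at least `δ R`,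
  -- which exceed `δ (4 * R)`.
  set K : ℝ := max (K₁ * (c * c)) (patchCount T (4 * R)) with hK
  refine ⟨Real.toNNReal (K * (1 + K')), fun ξ s hs F hF => ?_⟩
  refine (sum_le_mul_of_levels (D := fun n => δ (4 ^ n * R)) (K := K) (K' := K')
    (S := distancesFrom ξ) (fun n => δ.pos (by linarith [hx n])) ?_ (fun t ht => ht.1)
    (fun n G hG => ?_) (fun G hG => ?_) (fun n N => ?_) hs.1 F hF).trans
    (mul_le_mul_of_nonneg_right (Real.le_coe_toNNReal _) hs.1.le)
  · exact δ.tendsto_zero.comp ((tendsto_pow_atTop_atTop_of_one_lt (by norm_num)).atTop_mul_const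
      (by linarith))
  · refine le_trans ?_ (le_max_left _ _)
    have hxn := hx n
    set x : ℝ := 4 ^ n * R with hxdef
    -- The gap contains its lower end `δ (4 * x)` but the counting bound needs an open interval.
    -- Going down to `δ (16 * x)` costs a second factor `c`.
    have hG' : (G : Set ℝ) ⊆ distancesFrom ξ ∩ Ioo (δ (4 * (4 * x))) (δ x) := by
      intro t ht
      have h2 : δ (4 ^ (n + 1) * R) ≤ t := (hG ht).2.1
      rw [hsucc] at h2
      exact ⟨(hG ht).1, (δ.lt_of_lt (by linarith) (by linarith)).trans_le h2, (hG ht).2.2⟩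
    have h1 := hK₁ ξ x (4 * (4 * x)) (by linarith) (by linarith) G hG'
    have hp : (0 : ℝ) < patchCount T x := Nat.cast_pos.2 (patchCount_pos hFLC ξ (by linarith))
    have hp' : (0 : ℝ) < patchCount T (4 * x) :=
      Nat.cast_pos.2 (patchCount_pos hFLC ξ (by linarith))
    have h2 := hR₁ x (by linarith)
    have h3 := hR₁ (4 * x) (by linarith)
    have hc : 0 ≤ c := nonneg_of_mul_nonneg_left (hp'.le.trans h2) hp
    refine le_of_mul_le_mul_right (h1.trans ?_) hp
    calc K₁ * (patchCount T (4 * (4 * x)) : ℝ)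
        ≤ K₁ * (c * (c * patchCount T x)) :=
          mul_le_mul_of_nonneg_left (h3.trans (mul_le_mul_of_nonneg_left h2 hc)) hK₁0
      _ = K₁ * (c * c) * patchCount T x := by ring
  · refine le_trans ?_ (le_max_right _ _)
    refine Nat.cast_le.2 (card_distances_le_patchCount hFLC ξ (by linarith) fun t ht => ?_)
    have h2 : δ (4 ^ 0 * R) ≤ t := (hG ht).2
    rw [pow_zero, one_mul] at h2
    exact ⟨(hG ht).1, (δ.lt_of_lt (by linarith) (by linarith)).trans_le h2⟩
  · have := hK' _ (hx n) N
    refine (Finset.sum_congr rfl fun m _ => ?_).trans_le this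
    rw [pow_add, mul_comm ((4 : ℝ) ^ n), mul_assoc]

end Tilings
end TilingSpectral

theorem mainTheorem3 {d : ℕ} {L : Type*} (T : Set (TilingSpectral.MarkedSet d L))
    (hT : TilingSpectral.IsPuncturedTiling T)
    (hFLC : TilingSpectral.FiniteLocalComplexity T)
    (hfreq : TilingSpectral.EquidistributedFrequencies T)
    (hP : ∃ c : ℝ, ∀ᶠ r : ℝ in atTop,
      (TilingSpectral.patchCount T (4 * r) : ℝ) ≤ c * (TilingSpectral.patchCount T r : ℝ))
    (δ : TilingSpectral.DecayFunction)
    (hδ_sub : ∃ R : ℝ, ∀ a r : ℝ, R ≤ a → R ≤ r → δ (a * r) ≤ δ a * δ r)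
    (hδ_int : IntegrableOn (fun x : ℝ => δ x / x) (Ici 1) volume) :
    (∃ C : ℝ≥0, 0 < C ∧ ∀ ξ η : TilingSpectral.DiscreteTilingSpace T δ,
      edist ξ η ≤ TilingSpectral.upperSpectralDist ξ η ∧
        TilingSpectral.upperSpectralDist ξ η ≤ C * edist ξ η) ∧
    (∃ C : ℝ≥0, 0 < C ∧ ∀ ξ η : TilingSpectral.DiscreteTilingSpace T δ,
      TilingSpectral.lowerSpectralDist ξ η ≤ TilingSpectral.upperSpectralDist ξ η ∧
        TilingSpectral.upperSpectralDist ξ η ≤ C * TilingSpectral.lowerSpectralDist ξ η) := by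
  obtain ⟨K, hK⟩ := TilingSpectral.exists_sum_distances_le hFLC hfreq hP hδ_sub hδ_int
  have hup : ∀ ξ η : TilingSpectral.DiscreteTilingSpace T δ,
      TilingSpectral.upperSpectralDist ξ η ≤ ((1 + 2 * K : ℝ≥0) : ℝ≥0∞) * edist ξ η := fun ξ η =>
    iSup_le fun τ => TilingSpectral.spectralDist_le
      (TilingSpectral.locallyFiniteDistances hFLC) hK τ ξ η
  have hlow : ∀ ξ η : TilingSpectral.DiscreteTilingSpace T δ,
      edist ξ η ≤ TilingSpectral.lowerSpectralDist ξ η := fun ξ η =>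
    le_iInf fun τ => TilingSpectral.edist_le_spectralDist τ ξ η
  have hlu : ∀ ξ η : TilingSpectral.DiscreteTilingSpace T δ,
      TilingSpectral.lowerSpectralDist ξ η ≤ TilingSpectral.upperSpectralDist ξ η :=
    fun ξ η => iInf_le_iSup
  refine ⟨⟨1 + 2 * K, by positivity, fun ξ η => ⟨(hlow ξ η).trans (hlu ξ η), hup ξ η⟩⟩,
    ⟨1 + 2 * K, by positivity, fun ξ η => ⟨hlu ξ η, (hup ξ η).trans ?_⟩⟩⟩
  gcongr
  exact hlow ξ η
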